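/- Let $k\ge 1$ and let $\Lambda$ be a row-finite $k$-graph without sources: a countable small category (identified with its set of morphisms, called paths; $\Lambda^0$ is the set of objects) with range and source maps $r,s$ and a functor $d:\Lambda\to\mathbb N^k$ with the unique factorization property (if $d(\lambda)=m+n$, there are unique $\mu,\nu\in\Lambda$ with $s(\mu)=r(\nu)$, $d(\mu)=m$, $d(\nu)=n$, $\lambda=\mu\nu$), such that $v\Lambda^n:=\{\lambda: r(\lambda)=v,\ d(\lambda)=n\}$ is finite and nonempty for all $v\in\Lambda^0$, $n\in\mathbb N^k$. Let $R$ be a commutative ring with $1\neq 0$, and let ${\rm KP}_R(\Lambda)$ be the Kumjian-Pask algebra, i.e. the (not necessarily unital) $R$-algebra generated by a universal family $p_v$ $(v\in\Lambda^0)$, $s_\lambda, s_{\lambda^*}$ $(d(\lambda)\ne 0)$ subject to: (KP1) the $p_v$ are mutually orthogonal idempotents; (KP2) $s_\lambda s_\mu=s_{\lambda\mu}$ and $s_{\mu^*}s_{\lambda^*}=s_{(\lambda\mu)^*}$ if $s(\lambda)=r(\mu)$, and $p_{r(\lambda)}s_\lambda=s_\lambda=s_\lambda p_{s(\lambda)}$,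 $p_{s(\lambda)}s_{\lambda^*}=s_{\lambda^*}=s_{\lambda^*}p_{r(\lambda)}$; (KP3) $s_{\lambda^*}s_\mu=\delta_{\lambda,\mu}p_{s(\lambda)}$ if $d(\lambda)=d(\mu)$; (KP4) $p_v=\sum_{\lambda\in v\Lambda^n}s_\lambda s_{\lambda^*}$ for all $v\in\Lambda^0$ and $n\ne 0$. Identifying paths of degree $0$ with objects, put $s_v=s_{v^*}=p_v$ for $v\in\Lambda^0$. A pair $(\alpha,\beta)\in\Lambda\times\Lambda$ is called a cycline pair if $s(\alpha)=s(\beta)$ and $s_{\alpha\gamma}s_{(\alpha\gamma)^*}=s_{\beta\gamma}s_{(\beta\gamma)^*}$ for all $\gamma\in\Lambda$ with $r(\gamma)=s(\alpha)$. Let $\mathcal M$ (the cycline subalgebra) and $\mathcal D$ (the diagonal subalgebra) be the $R$-subalgebras of ${\rm KP}_R(\Lambda)$ generated by $\{s_\alpha s_{\beta^*}: (\alpha,\beta)\text{ cycline}\}$ and $\{s_\mu s_{\mu^*}:\mu\in\Lambda\}$, respectively. Let $\Omega_k$ be the category with object set $\mathbb N^k$ and exactly one morphism $(p,q)$, with range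 $p$, source $q$ and degree $q-p$, whenever $p\le q$. An infinite path is a degree-preserving functor $x:\Omega_k\to\Lambda$; its range is $x(0,0)$. It is periodic if there are $p\neq q$ in $\mathbb N^k$ with $x(m+p,n+p)=x(m+q,n+q)$ for all $m\le n$ in $\mathbb N^k$, and aperiodic otherwise. $\Lambda$ is aperiodic if every $v\in\Lambda^0$ is the range of an aperiodic infinite path. **Lemma.** If $\Lambda$ is aperiodic, then for all $\alpha,\beta\in\Lambda$, $(\alpha,\beta)$ is a cycline pair if and only if $\alpha=\beta$. In particular, $\mathcal M=\mathcal D$. -/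

import Mathlib

universe u

/-- A `k`-graph: a countable small category, presented by its objects (`Vertex`), its morphisms
(`Path`), the range and source maps `r` and `s`, the identities and the composition `μν`
(defined when `s μ = r ν`), together with a degree functor `d` to the additive monoid `ℕ^k`
that has the unique factorization property. -/
structure KGraph (k : ℕ) where
  Vertex : Type u
  Path : Type u
  countable_path : Countable Path
  r : Path → Vertex
  s : Path → Vertex
  ident : Vertex → Path
  r_ident : ∀ v, r (ident v) = v
  s_ident : ∀ v, s (ident v) = v
  comp : (μ ν : Path) → s μ = r ν → Path
  r_comp : ∀ μ ν h, r (comp μ ν h) = r μ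
  s_comp : ∀ μ ν h, s (comp μ ν h) = s ν
  ident_comp : ∀ μ, comp (ident (r μ)) μ (s_ident (r μ)) = μ
  comp_ident : ∀ μ, comp μ (ident (s μ)) (r_ident (s μ)).symm = μ
  assoc : ∀ l μ ν (h : s l = r μ) (h' : s μ = r ν),
    comp (comp l μ h) ν ((s_comp l μ h).trans h') = comp l (comp μ ν h') (h.trans (r_comp μ ν h').symm)
  d : Path → (Fin k → ℕ)
  d_ident : ∀ v, d (ident v) = 0
  d_comp : ∀ μ ν h, d (comp μ ν h) = d μ + d ν
  factorization : ∀ (l : Path) (m n : Fin k → ℕ), d l = m + n →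
    ∃! p : Path × Path, d p.1 = m ∧ d p.2 = n ∧ ∃ h : s p.1 = r p.2, comp p.1 p.2 h = l

namespace KGraph

variable {k : ℕ} (Λ : KGraph.{u} k)

/-- The set `vΛⁿ` of paths of degree `n` with range `v`. -/
def pathsFrom (v : Λ.Vertex) (n : Fin k → ℕ) : Set Λ.Path := {l | Λ.r l = v ∧ Λ.d l = n}

def RowFinite : Prop := ∀ v n, (Λ.pathsFrom v n).Finite

def NoSources : Prop := ∀ v n, (Λ.pathsFrom v n).Nonempty

/-- An infinite path: a degree-preserving functor from the category `Ω_k` (objects `ℕ^k`, one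
morphism `(p, q)` with range `p`, source `q` and degree `q - p` for each `p ≤ q`) to `Λ`. -/
@[ext] structure InfinitePath where
  obj : (Fin k → ℕ) → Λ.Vertex
  map : (p q : Fin k → ℕ) → p ≤ q → Λ.Path
  r_map : ∀ p q h, Λ.r (map p q h) = obj p
  s_map : ∀ p q h, Λ.s (map p q h) = obj q
  map_self : ∀ p, map p p le_rfl = Λ.ident (obj p)
  map_comp : ∀ p q t (h : p ≤ q) (h' : q ≤ t),
    Λ.comp (map p q h) (map q t h') ((s_map p q h).trans (r_map q t h').symm)
      = map p t (h.trans h')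
  d_map : ∀ p q h, Λ.d (map p q h) = q - p

namespace InfinitePath

variable {Λ}

/-- The range `r(x) = x(0, 0)`. -/
def range (x : Λ.InfinitePath) : Λ.Vertex := x.obj 0

/-- The shift `σ^p`, `σ^p(x)(m, n) = x(m + p, n + p)`. -/
def shift (p : Fin k → ℕ) (x : Λ.InfinitePath) : Λ.InfinitePath where
  obj m := x.obj (m + p)
  map m n h := x.map (m + p) (n + p) (add_le_add_left h p)
  r_map _ _ _ := x.r_map _ _ _
  s_map _ _ _ := x.s_map _ _ _
  map_self _ := x.map_self _
  map_comp _ _ _ _ _ := x.map_comp _ _ _ _ _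
  d_map _ _ _ := by rw [x.d_map]; exact add_tsub_add_eq_tsub_right _ _ _

def IsPeriodic (x : Λ.InfinitePath) : Prop := ∃ p q : Fin k → ℕ, p ≠ q ∧ x.shift p = x.shift q

end InfinitePath

/-- `Λ` is aperiodic if every vertex is the range of an aperiodic infinite path. -/
def Aperiodic : Prop := ∀ v : Λ.Vertex, ∃ x : Λ.InfinitePath, x.range = v ∧ ¬ x.IsPeriodic

/-- The extension to all paths of `P` on vertices and `S` on paths of nonzero degree, by the
convention `S_v = P_v` (a path of degree `0` is identified with the vertex that is its range). -/
def extend {A : Type*} (P : Λ.Vertex → A) (S : {l : Λ.Path // Λ.d l ≠ 0} → A) (l : Λ.Path) : A :=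
  if h : Λ.d l = 0 then P (Λ.r l) else S ⟨l, h⟩

/-- Kumjian-Pask `Λ`-families `(P, S)` in a (not necessarily unital) ring `A`; `S l` stands for
`S_l` and `T l` for `S_{l^*}`. The sum in `kp4` is over the finite set `vΛⁿ`. -/
structure IsKPFamily {A : Type*} [NonUnitalRing A] (P : Λ.Vertex → A)
    (S T : {l : Λ.Path // Λ.d l ≠ 0} → A) : Prop where
  kp1_idem : ∀ v, P v * P v = P v
  kp1_orth : ∀ v w, v ≠ w → P v * P w = 0
  kp2_comp : ∀ (l μ : {l : Λ.Path // Λ.d l ≠ 0}) (h : Λ.s l = Λ.r μ)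
    (h0 : Λ.d (Λ.comp l μ h) ≠ 0), S l * S μ = S ⟨Λ.comp l μ h, h0⟩
  kp2_ghost_comp : ∀ (l μ : {l : Λ.Path // Λ.d l ≠ 0}) (h : Λ.s l = Λ.r μ)
    (h0 : Λ.d (Λ.comp l μ h) ≠ 0), T μ * T l = T ⟨Λ.comp l μ h, h0⟩
  kp2_range : ∀ l : {l : Λ.Path // Λ.d l ≠ 0}, P (Λ.r l) * S l = S l
  kp2_source : ∀ l : {l : Λ.Path // Λ.d l ≠ 0}, S l * P (Λ.s l) = S l
  kp2_ghost_source : ∀ l : {l : Λ.Path // Λ.d l ≠ 0}, P (Λ.s l) * T l = T l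
  kp2_ghost_range : ∀ l : {l : Λ.Path // Λ.d l ≠ 0}, T l * P (Λ.r l) = T l
  kp3_eq : ∀ l : {l : Λ.Path // Λ.d l ≠ 0}, T l * S l = P (Λ.s l)
  kp3_ne : ∀ l μ : {l : Λ.Path // Λ.d l ≠ 0}, Λ.d l = Λ.d μ → l ≠ μ → T l * S μ = 0
  kp4 : ∀ (v : Λ.Vertex) (n : Fin k → ℕ), n ≠ 0 → ∀ F : Finset Λ.Path,
    (∀ l, l ∈ F ↔ l ∈ Λ.pathsFrom v n) → P v = ∑ l ∈ F, Λ.extend P S l * Λ.extend P T l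

/-- The generators of the Kumjian-Pask algebra: vertices, paths of nonzero degree, and ghost
paths of nonzero degree. -/
inductive Gen where
  | vertex (v : Λ.Vertex)
  | path (l : {l : Λ.Path // Λ.d l ≠ 0})
  | ghost (l : {l : Λ.Path // Λ.d l ≠ 0})

section Algebra

variable (R : Type*) [CommRing R]

/-- The generator `P_v` of the free algebra. -/
def freeP (v : Λ.Vertex) : FreeAlgebra R Λ.Gen := FreeAlgebra.ι R (Gen.vertex v)

/-- The generator `S_l` of the free algebra. -/
def freeS (l : {l : Λ.Path // Λ.d l ≠ 0}) : FreeAlgebra R Λ.Gen := FreeAlgebra.ι R (Gen.path l)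

/-- The generator `S_{l^*}` of the free algebra. -/
def freeT (l : {l : Λ.Path // Λ.d l ≠ 0}) : FreeAlgebra R Λ.Gen := FreeAlgebra.ι R (Gen.ghost l)

/-- The Kumjian-Pask relations (KP1)-(KP4) between the generators of the free algebra. -/
inductive KPRel : FreeAlgebra R Λ.Gen → FreeAlgebra R Λ.Gen → Prop
  | kp1_idem (v : Λ.Vertex) : KPRel (Λ.freeP R v * Λ.freeP R v) (Λ.freeP R v)
  | kp1_orth (v w : Λ.Vertex) (h : v ≠ w) : KPRel (Λ.freeP R v * Λ.freeP R w) 0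
  | kp2_comp (l μ : {l : Λ.Path // Λ.d l ≠ 0}) (h : Λ.s l = Λ.r μ)
      (h0 : Λ.d (Λ.comp l μ h) ≠ 0) :
      KPRel (Λ.freeS R l * Λ.freeS R μ) (Λ.freeS R ⟨Λ.comp l μ h, h0⟩)
  | kp2_ghost_comp (l μ : {l : Λ.Path // Λ.d l ≠ 0}) (h : Λ.s l = Λ.r μ)
      (h0 : Λ.d (Λ.comp l μ h) ≠ 0) :
      KPRel (Λ.freeT R μ * Λ.freeT R l) (Λ.freeT R ⟨Λ.comp l μ h, h0⟩)
  | kp2_range (l : {l : Λ.Path // Λ.d l ≠ 0}) :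
      KPRel (Λ.freeP R (Λ.r l) * Λ.freeS R l) (Λ.freeS R l)
  | kp2_source (l : {l : Λ.Path // Λ.d l ≠ 0}) :
      KPRel (Λ.freeS R l * Λ.freeP R (Λ.s l)) (Λ.freeS R l)
  | kp2_ghost_source (l : {l : Λ.Path // Λ.d l ≠ 0}) :
      KPRel (Λ.freeP R (Λ.s l) * Λ.freeT R l) (Λ.freeT R l)
  | kp2_ghost_range (l : {l : Λ.Path // Λ.d l ≠ 0}) :
      KPRel (Λ.freeT R l * Λ.freeP R (Λ.r l)) (Λ.freeT R l)
  | kp3_eq (l : {l : Λ.Path // Λ.d l ≠ 0}) :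
      KPRel (Λ.freeT R l * Λ.freeS R l) (Λ.freeP R (Λ.s l))
  | kp3_ne (l μ : {l : Λ.Path // Λ.d l ≠ 0}) (h : Λ.d l = Λ.d μ) (hne : l ≠ μ) :
      KPRel (Λ.freeT R l * Λ.freeS R μ) 0
  | kp4 (v : Λ.Vertex) (n : Fin k → ℕ) (hn : n ≠ 0) (F : Finset Λ.Path)
      (hF : ∀ l, l ∈ F ↔ l ∈ Λ.pathsFrom v n) :
      KPRel (Λ.freeP R v)
        (∑ l ∈ F, Λ.extend (Λ.freeP R) (Λ.freeS R) l * Λ.extend (Λ.freeP R) (Λ.freeT R) l)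

/-- The unital `R`-algebra presented by the generators and the Kumjian-Pask relations. It is the
unitization of the Kumjian-Pask algebra. -/
abbrev KPUnital : Type _ := RingQuot (Λ.KPRel R)

/-- The image of a generator in the presented unital algebra. -/
def KPUnital.gen (g : Λ.Gen) : Λ.KPUnital R :=
  RingQuot.mkAlgHom R (Λ.KPRel R) (FreeAlgebra.ι R g)

/-- The Kumjian-Pask algebra `KP_R(Λ)`, in general without a unit: the non-unital subalgebra
generated by the universal family. Its universal property is `KP.existsUnique_lift` below. -/
abbrev KP : NonUnitalSubalgebra R (Λ.KPUnital R) :=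
  NonUnitalAlgebra.adjoin R (Set.range (KPUnital.gen Λ R))

namespace KP

variable {Λ}

/-- The generators in the Kumjian-Pask algebra. -/
def gen (g : Λ.Gen) : Λ.KP R :=
  ⟨KPUnital.gen Λ R g, NonUnitalAlgebra.subset_adjoin R (Set.mem_range_self g)⟩

/-- The element `p_v`. -/
def p (v : Λ.Vertex) : Λ.KP R := gen R (Gen.vertex v)

/-- The element `s_l` for an arbitrary path `l`, with `s_v = p_v`. -/
def s (l : Λ.Path) : Λ.KP R := Λ.extend (p R) (fun l => gen R (Gen.path l)) l

/-- The element `s_{l^*}` for an arbitrary path `l`, with `s_{v^*} = p_v`. -/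
def sStar (l : Λ.Path) : Λ.KP R := Λ.extend (p R) (fun l => gen R (Gen.ghost l)) l

end KP

variable {Λ} in
/-- `(α, β)` is a cycline pair: `s(α) = s(β)` and
`s_{αγ} s_{(αγ)^*} = s_{βγ} s_{(βγ)^*}` for all `γ ∈ s(α)Λ`. -/
structure IsCyclinePair (α β : Λ.Path) : Prop where
  source_eq : Λ.s α = Λ.s β
  proj_eq : ∀ (γ : Λ.Path) (h : Λ.s α = Λ.r γ),
    KP.s R (Λ.comp α γ h) * KP.sStar R (Λ.comp α γ h)
      = KP.s R (Λ.comp β γ (source_eq.symm.trans h))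
        * KP.sStar R (Λ.comp β γ (source_eq.symm.trans h))

/-- The diagonal subalgebra `𝓓`, generated by the elements `s_μ s_{μ^*}`. -/
def diagonal : NonUnitalSubalgebra R (Λ.KP R) :=
  NonUnitalAlgebra.adjoin R {a | ∃ μ : Λ.Path, a = KP.s R μ * KP.sStar R μ}

/-- The cycline subalgebra `𝓜`, generated by the `s_α s_{β^*}` with `(α, β)` cycline. -/
def cyclineSubalgebra : NonUnitalSubalgebra R (Λ.KP R) :=
  NonUnitalAlgebra.adjoin R
    {a | ∃ α β : Λ.Path, IsCyclinePair R α β ∧ a = KP.s R α * KP.sStar R β}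

/-! The generators of `KP_R(Λ)` form a Kumjian-Pask family, and it is universal. -/

variable {Λ}

theorem map_extend {A B : Type*} (f : A → B) (P : Λ.Vertex → A)
    (S : {l : Λ.Path // Λ.d l ≠ 0} → A) (l : Λ.Path) :
    f (Λ.extend P S l) = Λ.extend (fun v => f (P v)) (fun l => f (S l)) l := by
  unfold extend; split <;> rfl

theorem KP.isKPFamily : Λ.IsKPFamily (KP.p R) (fun l => KP.gen R (Gen.path l))
    (fun l => KP.gen R (Gen.ghost l)) := by
  have key : ∀ {x y : FreeAlgebra R Λ.Gen}, Λ.KPRel R x y →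
      RingQuot.mkAlgHom R (Λ.KPRel R) x = RingQuot.mkAlgHom R (Λ.KPRel R) y :=
    fun h => RingQuot.mkAlgHom_rel R h
  constructor
  · intro v
    exact Subtype.ext ((map_mul _ _ _).symm.trans (key (.kp1_idem v)))
  · intro v w h
    exact Subtype.ext ((map_mul _ _ _).symm.trans ((key (.kp1_orth v w h)).trans (map_zero _)))
  · intro l μ h h0
    exact Subtype.ext ((map_mul _ _ _).symm.trans (key (.kp2_comp l μ h h0)))
  · intro l μ h h0
    exact Subtype.ext ((map_mul _ _ _).symm.trans (key (.kp2_ghost_comp l μ h h0)))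
  · intro l
    exact Subtype.ext ((map_mul _ _ _).symm.trans (key (.kp2_range l)))
  · intro l
    exact Subtype.ext ((map_mul _ _ _).symm.trans (key (.kp2_source l)))
  · intro l
    exact Subtype.ext ((map_mul _ _ _).symm.trans (key (.kp2_ghost_source l)))
  · intro l
    exact Subtype.ext ((map_mul _ _ _).symm.trans (key (.kp2_ghost_range l)))
  · intro l
    exact Subtype.ext ((map_mul _ _ _).symm.trans (key (.kp3_eq l)))
  · intro l μ h hne
    exact Subtype.ext ((map_mul _ _ _).symm.trans ((key (.kp3_ne l μ h hne)).trans (map_zero _)))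
  · intro v n hn F hF
    apply Subtype.ext
    refine (key (.kp4 v n hn F hF)).trans ?_
    rw [map_sum, AddSubmonoidClass.coe_finsetSum]
    refine Finset.sum_congr rfl fun l _ => ?_
    rw [map_mul, NonUnitalSubalgebra.coe_mul, map_extend (RingQuot.mkAlgHom R (Λ.KPRel R)),
      map_extend (RingQuot.mkAlgHom R (Λ.KPRel R)), map_extend (Subtype.val : Λ.KP R → _),
      map_extend (Subtype.val : Λ.KP R → _)]
    rfl

theorem KP.existsUnique_lift {A : Type*} [NonUnitalRing A] [Module R A] [IsScalarTower R A A]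
    [SMulCommClass R A A] (P : Λ.Vertex → A) (S T : {l : Λ.Path // Λ.d l ≠ 0} → A)
    (hf : Λ.IsKPFamily P S T) :
    ∃! φ : Λ.KP R →ₙₐ[R] A, (∀ v, φ (KP.p R v) = P v) ∧
      (∀ l, φ (KP.gen R (Gen.path l)) = S l) ∧ (∀ l, φ (KP.gen R (Gen.ghost l)) = T l) := by
  let g : Λ.Gen → A := fun x => match x with
    | .vertex v => P v
    | .path l => S l
    | .ghost l => T l
  let f0 : FreeAlgebra R Λ.Gen →ₐ[R] Unitization R A :=
    FreeAlgebra.lift R (fun x => (g x : Unitization R A))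
  have fι : ∀ x, f0 (FreeAlgebra.ι R x) = (g x : Unitization R A) := fun x => by simp [f0]
  have fP : ∀ v, f0 (Λ.freeP R v) = (P v : Unitization R A) := fun v => fι _
  have fS : ∀ l, f0 (Λ.freeS R l) = (S l : Unitization R A) := fun l => fι _
  have fT : ∀ l, f0 (Λ.freeT R l) = (T l : Unitization R A) := fun l => fι _
  have hrel : ∀ ⦃x y⦄, Λ.KPRel R x y → f0 x = f0 y := by
    intro x y h
    induction h with
    | kp1_idem v => rw [map_mul, fP, ← Unitization.inr_mul, hf.kp1_idem]
    | kp1_orth v w h =>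
      rw [map_mul, fP, fP, ← Unitization.inr_mul, hf.kp1_orth v w h, map_zero,
        Unitization.inr_zero]
    | kp2_comp l μ h h0 => rw [map_mul, fS, fS, fS, ← Unitization.inr_mul, hf.kp2_comp l μ h h0]
    | kp2_ghost_comp l μ h h0 =>
      rw [map_mul, fT, fT, fT, ← Unitization.inr_mul, hf.kp2_ghost_comp l μ h h0]
    | kp2_range l => rw [map_mul, fP, fS, ← Unitization.inr_mul, hf.kp2_range]
    | kp2_source l => rw [map_mul, fP, fS, ← Unitization.inr_mul, hf.kp2_source]
    | kp2_ghost_source l => rw [map_mul, fP, fT, ← Unitization.inr_mul, hf.kp2_ghost_source]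
    | kp2_ghost_range l => rw [map_mul, fP, fT, ← Unitization.inr_mul, hf.kp2_ghost_range]
    | kp3_eq l => rw [map_mul, fP, fT, fS, ← Unitization.inr_mul, hf.kp3_eq]
    | kp3_ne l μ h hne =>
      rw [map_mul, fT, fS, ← Unitization.inr_mul, hf.kp3_ne l μ h hne, map_zero,
        Unitization.inr_zero]
    | kp4 v n hn F hF =>
      rw [fP, hf.kp4 v n hn F hF, map_sum]
      refine (map_sum (Unitization.inrNonUnitalAlgHom R A) _ _).trans
        (Finset.sum_congr rfl fun l _ => ?_)
      rw [map_mul, map_mul, map_extend f0, map_extend f0,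
        map_extend (Unitization.inrNonUnitalAlgHom R A),
        map_extend (Unitization.inrNonUnitalAlgHom R A)]
      simp only [fP, fS, fT]
      rfl
  let f1 : Λ.KPUnital R →ₐ[R] Unitization R A := RingQuot.liftAlgHom R ⟨f0, hrel⟩
  have f1g : ∀ x, f1 (KPUnital.gen Λ R x) = (g x : Unitization R A) := fun x =>
    (RingQuot.liftAlgHom_mkAlgHom_apply (S := R) f0 hrel (FreeAlgebra.ι R x)).trans (fι x)
  have hfst : ∀ a ∈ Λ.KP R, (f1 a).fst = 0 := by
    intro a ha
    induction ha using NonUnitalAlgebra.adjoin_induction with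
    | mem x hx => obtain ⟨y, rfl⟩ := hx; rw [f1g]; rfl
    | add x y _ _ hx hy => rw [map_add, Unitization.fst_add, hx, hy, add_zero]
    | zero => rw [map_zero]; rfl
    | mul x y _ _ hx hy => rw [map_mul, Unitization.fst_mul, hx, zero_mul]
    | smul c x _ hx => rw [map_smul, Unitization.fst_smul, hx, smul_zero]
  let φ : Λ.KP R →ₙₐ[R] A :=
    { toFun := fun a => (f1 a).snd
      map_smul' := fun c a => by simp
      map_zero' := by simp
      map_add' := fun a b => by simp
      map_mul' := fun a b => by simp [hfst a a.2, hfst b b.2] }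
  have hφ : ∀ x, φ (KP.gen R x) = g x := fun x => congrArg (fun z : Unitization R A => z.snd) (f1g x)
  refine ⟨φ, ⟨fun v => hφ _, fun l => hφ _, fun l => hφ _⟩, ?_⟩
  rintro ψ ⟨h1, h2, h3⟩
  have hψ : ∀ x, ψ (KP.gen R x) = φ (KP.gen R x) := by
    intro x
    rw [hφ]
    cases x with
    | vertex v => exact h1 v
    | path l => exact h2 l
    | ghost l => exact h3 l
  have : ∀ a (ha : a ∈ Λ.KP R), ψ ⟨a, ha⟩ = φ ⟨a, ha⟩ := by
    intro a ha
    induction ha using NonUnitalAlgebra.adjoin_induction with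
    | mem x hx => obtain ⟨y, rfl⟩ := hx; exact hψ y
    | add x y hx hy ex ey =>
      exact (map_add ψ ⟨x, hx⟩ ⟨y, hy⟩).trans
        ((congrArg₂ (· + ·) ex ey).trans (map_add φ ⟨x, hx⟩ ⟨y, hy⟩).symm)
    | zero => exact (map_zero ψ).trans (map_zero φ).symm
    | mul x y hx hy ex ey =>
      exact (map_mul ψ ⟨x, hx⟩ ⟨y, hy⟩).trans
        ((congrArg₂ (· * ·) ex ey).trans (map_mul φ ⟨x, hx⟩ ⟨y, hy⟩).symm)
    | smul c x hx ex =>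
      exact (map_smul ψ c ⟨x, hx⟩).trans
        ((congrArg (c • ·) ex).trans (map_smul φ c ⟨x, hx⟩).symm)
  exact NonUnitalAlgHom.ext fun a => this a a.2

end Algebra

end KGraph

/-! `KP_R(Λ)` acts on the functions from infinite paths to `R`: `s_l` sends `f` to the function `x ↦
f(σ^{d(l)} x)` supported on the cylinder of paths beginning with `l`, and `s_{l^*}` sends `f` to `x
↦ f(lx)`. Hence `s_l s_{l^*}` acts as multiplication by the indicator of the cylinder of `l`, and
since `1 ≠ 0` in `R`, equal projections have equal cylinders (`init_eq_iff_of_proj_eq`).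

If `(α, β)` is cycline and `x` starts at `s(α)`, then for each `n` the path `αx` lies in the
cylinder of `αγ`, hence of `βγ`, where `γ = x(0,n)`. Letting `n` vary gives `αx = βx`
(`IsCyclinePair.concat_eq`). Shifting this path by `d(α) + d(β)` yields `σ^{d(β)} x = σ^{d(α)} x`.
For aperiodic `x` this forces `d(α) = d(β)`, and then `α` and `β` are the same initial segment of
one infinite path. -/

namespace KGraph

variable {k : ℕ} {Λ : KGraph.{u} k}

/-! ### Finite paths: cancellation and initial segments -/

theorem comp_congr {μ μ' ν ν' : Λ.Path} (hμ : μ = μ') (hν : ν = ν') (h : Λ.s μ = Λ.r ν) :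
    Λ.comp μ ν h = Λ.comp μ' ν' (hμ ▸ hν ▸ h) := by
  subst hμ hν; rfl

/-- Uniqueness of factorization, with the second degrees matched automatically because addition in
`ℕ^k` is cancellative. -/
theorem comp_cancel {μ ν μ' ν' : Λ.Path} (h : Λ.s μ = Λ.r ν) (h' : Λ.s μ' = Λ.r ν')
    (hd : Λ.d μ = Λ.d μ') (he : Λ.comp μ ν h = Λ.comp μ' ν' h') : μ = μ' ∧ ν = ν' := by
  have hd' : Λ.d ν = Λ.d ν' := by
    have := congrArg Λ.d he
    rw [Λ.d_comp, Λ.d_comp, hd] at this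
    exact add_left_cancel this
  have := (Λ.factorization _ _ _ (Λ.d_comp μ ν h)).unique
    (y₁ := (μ, ν)) (y₂ := (μ', ν')) ⟨rfl, rfl, h, rfl⟩ ⟨hd.symm, hd'.symm, h', he.symm⟩
  exact Prod.mk.inj this

theorem ident_r_of_d_eq_zero {l : Λ.Path} (hl : Λ.d l = 0) : Λ.ident (Λ.r l) = l :=
  (comp_cancel (Λ.s_ident _) (Λ.r_ident _).symm ((Λ.d_ident _).trans hl.symm)
    ((Λ.ident_comp l).trans (Λ.comp_ident l).symm)).1

/-- `μ` is an initial segment of `l`. -/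
def IsPrefix (μ l : Λ.Path) : Prop := ∃ ν, ∃ h : Λ.s μ = Λ.r ν, Λ.comp μ ν h = l

theorem isPrefix_comp (μ ν : Λ.Path) (h : Λ.s μ = Λ.r ν) : IsPrefix μ (Λ.comp μ ν h) :=
  ⟨ν, h, rfl⟩

theorem IsPrefix.trans {a b c : Λ.Path} (hab : IsPrefix a b) (hbc : IsPrefix b c) :
    IsPrefix a c := by
  obtain ⟨x, hx, rfl⟩ := hab
  obtain ⟨y, hy, rfl⟩ := hbc
  exact ⟨_, _, (Λ.assoc a x y hx ((Λ.s_comp a x hx).symm.trans hy)).symm⟩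

theorem IsPrefix.eq_of_d_eq {a b l : Λ.Path} (ha : IsPrefix a l) (hb : IsPrefix b l)
    (hd : Λ.d a = Λ.d b) : a = b := by
  obtain ⟨x, hx, rfl⟩ := ha
  obtain ⟨y, hy, e⟩ := hb
  exact (comp_cancel hx hy hd e.symm).1

theorem exists_isPrefix (l : Λ.Path) {n : Fin k → ℕ} (hn : n ≤ Λ.d l) :
    ∃ a, IsPrefix a l ∧ Λ.d a = n := by
  obtain ⟨⟨a, b⟩, ⟨h1, -, h, e⟩, -⟩ :=
    Λ.factorization l n (Λ.d l - n) (add_tsub_cancel_of_le hn).symm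
  exact ⟨a, ⟨b, h, e⟩, h1⟩

theorem IsPrefix.of_d_le {a b l : Λ.Path} (ha : IsPrefix a l) (hb : IsPrefix b l)
    (hd : Λ.d a ≤ Λ.d b) : IsPrefix a b := by
  obtain ⟨a', ha', hd'⟩ := exists_isPrefix b hd
  rwa [ha.eq_of_d_eq (ha'.trans hb) hd'.symm]

/-! ### Infinite paths: initial segments, shifts and concatenation -/

namespace InfinitePath

theorem map_congr (x : Λ.InfinitePath) {p q p' q' : Fin k → ℕ} (hp : p = p') (hq : q = q')
    (h : p ≤ q) : x.map p q h = x.map p' q' (hp ▸ hq ▸ h) := by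
  subst hp hq; rfl

/-- The initial segment `x(0, n)`. -/
def init (x : Λ.InfinitePath) (n : Fin k → ℕ) : Λ.Path := x.map 0 n zero_le

theorem r_init (x : Λ.InfinitePath) (n) : Λ.r (x.init n) = x.range := x.r_map _ _ _

theorem s_init (x : Λ.InfinitePath) (n) : Λ.s (x.init n) = x.obj n := x.s_map _ _ _

theorem d_init (x : Λ.InfinitePath) (n) : Λ.d (x.init n) = n := by
  rw [init, x.d_map, tsub_zero]

theorem init_zero (x : Λ.InfinitePath) : x.init 0 = Λ.ident x.range := x.map_self 0

theorem comp_init_map (x : Λ.InfinitePath) {m n : Fin k → ℕ} (h : m ≤ n) :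
    Λ.comp (x.init m) (x.map m n h) ((x.s_map _ _ _).trans (x.r_map _ _ _).symm) = x.init n :=
  x.map_comp _ _ _ _ _

theorem isPrefix_init (x : Λ.InfinitePath) {m n : Fin k → ℕ} (h : m ≤ n) :
    IsPrefix (x.init m) (x.init n) := ⟨_, _, x.comp_init_map h⟩

theorem range_shift (x : Λ.InfinitePath) (p) : (x.shift p).range = x.obj p :=
  congrArg x.obj (zero_add p)

theorem s_init_eq_r_init_shift (x : Λ.InfinitePath) (p n) :
    Λ.s (x.init p) = Λ.r ((x.shift p).init n) := by
  rw [s_init, r_init, range_shift]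

theorem comp_init_shift (x : Λ.InfinitePath) (p n : Fin k → ℕ) :
    Λ.comp (x.init p) ((x.shift p).init n) (x.s_init_eq_r_init_shift p n) = x.init (p + n) := by
  rw [← x.comp_init_map (le_self_add : p ≤ p + n)]
  exact comp_congr rfl (x.map_congr (zero_add p) (add_comm n p) _) _

theorem ext_init {x y : Λ.InfinitePath} (h : ∀ n, x.init n = y.init n) : x = y := by
  have hobj : x.obj = y.obj := funext fun n => by rw [← s_init, ← s_init, h]
  refine InfinitePath.ext hobj ?_
  funext p q hpq
  exact (comp_cancel _ _ (congrArg Λ.d (h p))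
    ((x.comp_init_map hpq).trans ((h q).trans (y.comp_init_map hpq).symm))).2

theorem shift_shift (x : Λ.InfinitePath) (p q) : (x.shift p).shift q = x.shift (p + q) :=
  ext_init fun n => x.map_congr (by abel) (by abel) _

/-- The segment of degree `n + m` is recovered from the head and the tail, and it determines its
prefix of degree `m`; comparing at `m` directly would fail, as `m` and `n` need not be comparable.
-/
theorem eq_of_init_eq_of_shift_eq {x y : Λ.InfinitePath} (n : Fin k → ℕ)
    (hi : x.init n = y.init n) (hs : x.shift n = y.shift n) : x = y := by
  refine ext_init fun m => ?_
  have key : x.init (n + m) = y.init (n + m) := by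
    rw [← comp_init_shift, ← comp_init_shift]
    exact comp_congr hi (by rw [hs]) _
  have hx := x.isPrefix_init (le_add_self : m ≤ n + m)
  rw [key] at hx
  exact hx.eq_of_d_eq (y.isPrefix_init le_add_self) (by rw [d_init, d_init])

/-- The infinite path with a prescribed coherent family of initial segments. -/
noncomputable def ofPrefixes (y : (Fin k → ℕ) → Λ.Path) (hd : ∀ n, Λ.d (y n) = n)
    (hy : ∀ m n, m ≤ n → IsPrefix (y m) (y n)) : Λ.InfinitePath where
  obj n := Λ.s (y n)
  -- The segment from `p` to `q` is the cofactor of `y p` in `y q`; it is unique by cancellation,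
  -- which gives the functor laws.
  map p q h := (hy p q h).choose
  r_map p q h := (hy p q h).choose_spec.choose.symm
  s_map p q h := by
    obtain ⟨h', e⟩ := (hy p q h).choose_spec
    rw [← Λ.s_comp _ _ h', e]
  map_self p := by
    obtain ⟨h', e⟩ := (hy p p le_rfl).choose_spec
    exact (comp_cancel h' (Λ.r_ident _).symm rfl (e.trans (Λ.comp_ident _).symm)).2
  map_comp p q t h h' := by
    obtain ⟨h₁, e₁⟩ := (hy p q h).choose_spec
    obtain ⟨h₂, e₂⟩ := (hy q t h').choose_spec
    obtain ⟨h₃, e₃⟩ := (hy p t (h.trans h')).choose_spec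
    have h₄ : Λ.s (hy p q h).choose = Λ.r (hy q t h').choose := by
      rw [← h₂, ← Λ.s_comp _ _ h₁, e₁]
    refine (comp_cancel (h₁.trans (Λ.r_comp _ _ h₄).symm) h₃ rfl ?_).2
    rw [← Λ.assoc _ _ _ h₁ h₄, e₃]
    exact (comp_congr e₁ rfl _).trans e₂
  d_map p q h := by
    obtain ⟨h', e⟩ := (hy p q h).choose_spec
    have := congrArg Λ.d e
    rw [Λ.d_comp, hd, hd] at this
    exact eq_tsub_of_add_eq ((add_comm _ _).trans this)

theorem init_ofPrefixes (y : (Fin k → ℕ) → Λ.Path) (hd : ∀ n, Λ.d (y n) = n)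
    (hy : ∀ m n, m ≤ n → IsPrefix (y m) (y n)) (n) : (ofPrefixes y hd hy).init n = y n := by
  obtain ⟨h', e⟩ := (hy 0 n zero_le).choose_spec
  -- `y 0` has degree `0`, so it is an identity and its cofactor in `y n` is `y n` itself.
  have h0 : Λ.ident (Λ.r (y 0)) = y 0 := ident_r_of_d_eq_zero (hd 0)
  have hr : Λ.r (y 0) = Λ.r (hy 0 n zero_le).choose := by
    rw [← h', ← Λ.s_ident (Λ.r (y 0)), h0]
  refine Eq.trans ?_ e
  refine (Λ.ident_comp _).symm.trans (comp_congr ?_ rfl _)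
  exact (congrArg Λ.ident hr.symm).trans h0

/-- The paths `w n = l x(0,n)` form a coherent family, but of degree `d(l) + n`; cutting each down
to its prefix `y n` of degree `n` gives the initial segments of `lx`. -/
theorem exists_concat (l : Λ.Path) (x : Λ.InfinitePath) (h : x.range = Λ.s l) :
    ∃ z : Λ.InfinitePath, z.init (Λ.d l) = l ∧ z.shift (Λ.d l) = x := by
  have hw (n) : Λ.s l = Λ.r (x.init n) := by rw [r_init, h]
  let w (n : Fin k → ℕ) : Λ.Path := Λ.comp l (x.init n) (hw n)
  have dw (n) : Λ.d (w n) = Λ.d l + n := by rw [Λ.d_comp, d_init]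
  have hwp (m n) (hmn : m ≤ n) : IsPrefix (w m) (w n) := by
    refine ⟨x.map m n hmn, by rw [Λ.s_comp, s_init, x.r_map], ?_⟩
    rw [Λ.assoc l (x.init m) (x.map m n hmn) (hw m) (by rw [s_init, x.r_map])]
    exact comp_congr rfl (x.comp_init_map hmn) _
  choose y hyw hyd using fun n =>
    exists_isPrefix (w n) (n := n) (by rw [dw]; exact le_add_self)
  have hy (m n) (hmn : m ≤ n) : IsPrefix (y m) (y n) :=
    ((hyw m).trans (hwp m n hmn)).of_d_le (hyw n) (by rwa [hyd, hyd])
  have h1 : (ofPrefixes y hyd hy).init (Λ.d l) = l := by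
    rw [init_ofPrefixes]
    exact (hyw _).eq_of_d_eq (isPrefix_comp _ _ _) (hyd _)
  refine ⟨ofPrefixes y hyd hy, h1, ext_init fun n => ?_⟩
  refine (comp_cancel (s_init_eq_r_init_shift _ _ _) (hw n) (by rw [h1]) ?_).2
  rw [comp_init_shift, init_ofPrefixes]
  exact (hyw _).eq_of_d_eq (hwp n _ le_add_self) (by rw [hyd, dw])

/-- The concatenation `lx` of a path and an infinite path. -/
noncomputable def concat (l : Λ.Path) (x : Λ.InfinitePath) (h : x.range = Λ.s l) :
    Λ.InfinitePath := (exists_concat l x h).choose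

theorem init_concat (l : Λ.Path) (x : Λ.InfinitePath) (h : x.range = Λ.s l) :
    (concat l x h).init (Λ.d l) = l := (exists_concat l x h).choose_spec.1

theorem shift_concat (l : Λ.Path) (x : Λ.InfinitePath) (h : x.range = Λ.s l) :
    (concat l x h).shift (Λ.d l) = x := (exists_concat l x h).choose_spec.2

theorem range_concat (l : Λ.Path) (x : Λ.InfinitePath) (h : x.range = Λ.s l) :
    (concat l x h).range = Λ.r l := by
  rw [← r_init _ (Λ.d l), init_concat]

theorem range_eq_r_of_init_eq {x : Λ.InfinitePath} {l : Λ.Path} (h : x.init (Λ.d l) = l) :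
    x.range = Λ.r l := by
  rw [← r_init x (Λ.d l), h]

theorem range_shift_of_init_eq {x : Λ.InfinitePath} {l : Λ.Path} (h : x.init (Λ.d l) = l) :
    (x.shift (Λ.d l)).range = Λ.s l := by
  rw [range_shift, ← s_init, h]

theorem concat_shift {x : Λ.InfinitePath} {l : Λ.Path} (h : x.init (Λ.d l) = l) :
    concat l (x.shift (Λ.d l)) (range_shift_of_init_eq h) = x :=
  eq_of_init_eq_of_shift_eq (Λ.d l) (by rw [init_concat, h]) (by rw [shift_concat])

theorem init_d_comp_eq_iff (x : Λ.InfinitePath) (l μ : Λ.Path) (h : Λ.s l = Λ.r μ) :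
    x.init (Λ.d (Λ.comp l μ h)) = Λ.comp l μ h ↔
      x.init (Λ.d l) = l ∧ (x.shift (Λ.d l)).init (Λ.d μ) = μ := by
  rw [Λ.d_comp, ← comp_init_shift]
  constructor
  · exact comp_cancel _ _ (d_init _ _)
  · rintro ⟨h1, h2⟩
    exact comp_congr h1 h2 _

theorem concat_concat (l μ : Λ.Path) (h : Λ.s l = Λ.r μ) (x : Λ.InfinitePath)
    (hx : x.range = Λ.s μ) :
    concat l (concat μ x hx) ((range_concat μ x hx).trans h.symm) =
      concat (Λ.comp l μ h) x (hx.trans (Λ.s_comp l μ h).symm) := by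
  refine eq_of_init_eq_of_shift_eq (Λ.d (Λ.comp l μ h)) ?_ ?_
  · rw [init_concat, init_d_comp_eq_iff, init_concat, shift_concat, init_concat]
    exact ⟨rfl, rfl⟩
  · rw [shift_concat, Λ.d_comp, ← shift_shift, shift_concat, shift_concat]

end InfinitePath

/-! ### The representation on functions on the infinite path space -/

section Representation

open InfinitePath

variable (R : Type*) [CommRing R]

open Classical in
/-- The action of `p_v` on functions on the infinite path space. -/
noncomputable def vertexOp (v : Λ.Vertex) : Module.End R (Λ.InfinitePath → R) where
  toFun f x := if x.range = v then f x else 0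
  map_add' f g := by funext x; by_cases h : x.range = v <;> simp [h]
  map_smul' c f := by funext x; by_cases h : x.range = v <;> simp [h]

open Classical in
/-- The action of `s_l` on functions on the infinite path space. -/
noncomputable def pathOp (l : Λ.Path) : Module.End R (Λ.InfinitePath → R) where
  toFun f x := if x.init (Λ.d l) = l then f (x.shift (Λ.d l)) else 0
  map_add' f g := by funext x; by_cases h : x.init (Λ.d l) = l <;> simp [h]
  map_smul' c f := by funext x; by_cases h : x.init (Λ.d l) = l <;> simp [h]

open Classical in
/-- The action of `s_{l^*}` on functions on the infinite path space. -/
noncomputable def ghostOp (l : Λ.Path) : Module.End R (Λ.InfinitePath → R) where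
  toFun f x := if h : x.range = Λ.s l then f (concat l x h) else 0
  map_add' f g := by funext x; by_cases h : x.range = Λ.s l <;> simp [h]
  map_smul' c f := by funext x; by_cases h : x.range = Λ.s l <;> simp [h]

open Classical in
theorem vertexOp_apply (v : Λ.Vertex) (f : Λ.InfinitePath → R) (x : Λ.InfinitePath) :
    vertexOp R v f x = if x.range = v then f x else 0 := rfl

open Classical in
theorem pathOp_apply (l : Λ.Path) (f : Λ.InfinitePath → R) (x : Λ.InfinitePath) :
    pathOp R l f x = if x.init (Λ.d l) = l then f (x.shift (Λ.d l)) else 0 := rfl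

open Classical in
theorem ghostOp_apply (l : Λ.Path) (f : Λ.InfinitePath → R) (x : Λ.InfinitePath) :
    ghostOp R l f x = if h : x.range = Λ.s l then f (concat l x h) else 0 := rfl

open Classical in
theorem pathOp_mul_ghostOp_apply (l : Λ.Path) (f : Λ.InfinitePath → R) (x : Λ.InfinitePath) :
    (pathOp R l * ghostOp R l) f x = if x.init (Λ.d l) = l then f x else 0 := by
  rw [Module.End.mul_apply, pathOp_apply]
  split_ifs with h
  · rw [ghostOp_apply, dif_pos (range_shift_of_init_eq h), concat_shift h]
  · rfl

/-- In degree `0` the convention `s_v = p_v` is consistent with the cylinder description: the prefix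
of degree `0` of `x` is the identity at its range. So no case split on degree is needed later. -/
theorem extend_vertexOp_mul_extend_vertexOp (l : Λ.Path) :
    Λ.extend (vertexOp R) (fun l => pathOp R l.1) l *
      Λ.extend (vertexOp R) (fun l => ghostOp R l.1) l = pathOp R l * ghostOp R l := by
  unfold extend
  split_ifs with h
  · refine LinearMap.ext fun f => funext fun x => ?_
    rw [pathOp_mul_ghostOp_apply, Module.End.mul_apply, vertexOp_apply, vertexOp_apply, h,
      init_zero]
    have : x.range = Λ.r l ↔ Λ.ident x.range = l := by
      constructor
      · intro e; rw [e, ident_r_of_d_eq_zero h]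
      · intro e; rw [← e, Λ.r_ident]
    by_cases e : x.range = Λ.r l
    · rw [if_pos e, if_pos e, if_pos (this.1 e)]
    · rw [if_neg e, if_neg (mt this.2 e)]
  · rfl

theorem isKPFamily_infinitePath :
    Λ.IsKPFamily (vertexOp R) (fun l => pathOp R l.1) (fun l => ghostOp R l.1) where
  kp1_idem v := by
    refine LinearMap.ext fun f => funext fun x => ?_
    rw [Module.End.mul_apply]
    simp only [vertexOp_apply]
    split_ifs <;> rfl
  kp1_orth v w hvw := by
    refine LinearMap.ext fun f => funext fun x => ?_
    rw [Module.End.mul_apply]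
    simp only [vertexOp_apply]
    split_ifs with h1 h2
    · exact absurd (h1.symm.trans h2) hvw
    all_goals rfl
  kp2_comp l μ h h0 := by
    refine LinearMap.ext fun f => funext fun x => ?_
    rw [Module.End.mul_apply]
    simp only [pathOp_apply, shift_shift, ← Λ.d_comp _ _ h]
    classical
    rw [← ite_and]
    exact if_congr (init_d_comp_eq_iff x _ _ h).symm rfl rfl
  kp2_ghost_comp l μ h h0 := by
    refine LinearMap.ext fun f => funext fun x => ?_
    rw [Module.End.mul_apply, ghostOp_apply, ghostOp_apply]
    by_cases hx : x.range = Λ.s μ.1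
    · rw [dif_pos hx, dif_pos (hx.trans (Λ.s_comp _ _ h).symm), ghostOp_apply,
        dif_pos ((range_concat _ _ hx).trans h.symm), concat_concat _ _ h]
    · rw [dif_neg hx, dif_neg (by rwa [Λ.s_comp])]
  kp2_range l := by
    refine LinearMap.ext fun f => funext fun x => ?_
    rw [Module.End.mul_apply, vertexOp_apply, pathOp_apply]
    split_ifs with h1 h2 h2
    · rfl
    · rfl
    · exact absurd (range_eq_r_of_init_eq h2) h1
    · rfl
  kp2_source l := by
    refine LinearMap.ext fun f => funext fun x => ?_
    rw [Module.End.mul_apply, pathOp_apply, pathOp_apply]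
    split_ifs with h
    · rw [vertexOp_apply, if_pos (range_shift_of_init_eq h)]
    · rfl
  kp2_ghost_source l := by
    refine LinearMap.ext fun f => funext fun x => ?_
    rw [Module.End.mul_apply, vertexOp_apply, ghostOp_apply]
    split_ifs <;> rfl
  kp2_ghost_range l := by
    refine LinearMap.ext fun f => funext fun x => ?_
    rw [Module.End.mul_apply, ghostOp_apply, ghostOp_apply]
    split_ifs with h
    · rw [vertexOp_apply, if_pos (range_concat _ _ h)]
    · rfl
  kp3_eq l := by
    refine LinearMap.ext fun f => funext fun x => ?_
    rw [Module.End.mul_apply, ghostOp_apply, vertexOp_apply]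
    split_ifs with h
    · rw [pathOp_apply, if_pos (init_concat _ _ h), shift_concat]
    · rfl
  kp3_ne l μ hd hne := by
    refine LinearMap.ext fun f => funext fun x => ?_
    rw [Module.End.mul_apply, ghostOp_apply]
    split_ifs with h
    · rw [pathOp_apply, if_neg, LinearMap.zero_apply, Pi.zero_apply]
      rw [← hd, init_concat]
      exact fun e => hne (Subtype.ext e)
    · rfl
  kp4 v n _ F hF := by
    simp only [extend_vertexOp_mul_extend_vertexOp]
    refine LinearMap.ext fun f => funext fun x => ?_
    rw [LinearMap.sum_apply, Finset.sum_apply, vertexOp_apply]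
    simp only [pathOp_mul_ghostOp_apply]
    -- The cylinders of the paths in `vΛⁿ` partition the infinite paths with range `v`: the only
    -- term that can survive at `x` is the one indexed by `x(0,n)`.
    have hmem : x.init n ∈ F ↔ x.range = v := by
      rw [hF]
      exact ⟨fun h => (x.r_init n).symm.trans h.1, fun h => ⟨(x.r_init n).trans h, x.d_init n⟩⟩
    have hterm : ∀ l ∈ F, (x.init (Λ.d l) = l ↔ x.init n = l) := fun l hl => by
      rw [((hF l).1 hl).2]
    split_ifs with h
    · rw [Finset.sum_eq_single_of_mem _ (hmem.2 h), if_pos (by rw [d_init])]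
      intro l hl hne
      exact if_neg fun e => hne ((hterm l hl).1 e).symm
    · refine (Finset.sum_eq_zero fun l hl => if_neg fun e => h (hmem.1 ?_)).symm
      rwa [(hterm l hl).1 e]

theorem init_eq_iff_of_proj_eq [Nontrivial R] {l μ : Λ.Path}
    (h : KP.s R l * KP.sStar R l = KP.s R μ * KP.sStar R μ) (x : Λ.InfinitePath) :
    x.init (Λ.d l) = l ↔ x.init (Λ.d μ) = μ := by
  obtain ⟨φ, ⟨hP, hS, hT⟩, -⟩ := KP.existsUnique_lift R _ _ _ (isKPFamily_infinitePath (Λ := Λ) R)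
  have hφ (l : Λ.Path) : φ (KP.s R l * KP.sStar R l) = pathOp R l * ghostOp R l := by
    rw [← extend_vertexOp_mul_extend_vertexOp, map_mul, KP.s, KP.sStar, map_extend φ,
      map_extend φ]
    simp only [hP, hS, hT]
  -- Applied to the constant function `1`, the two projections become the indicators of their
  -- cylinders.
  have key := congrArg (fun T => T (fun _ => (1 : R)) x)
    ((hφ l).symm.trans ((congrArg φ h).trans (hφ μ)))
  simp only [pathOp_mul_ghostOp_apply] at key
  split_ifs at key with h1 h2 h2
  · exact iff_of_true h1 h2
  · exact absurd key one_ne_zero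
  · exact absurd key zero_ne_one
  · exact iff_of_false h1 h2

/-! ### Cycline pairs and aperiodicity -/

variable {R}

/-- The cycline condition is tested on `γ = x(0,n)` for every `n`, so that `αx` begins with `β
x(0,n)` for all `n`. -/
theorem IsCyclinePair.concat_eq [Nontrivial R] {α β : Λ.Path} (h : IsCyclinePair R α β)
    (x : Λ.InfinitePath) (hx : x.range = Λ.s α) :
    concat α x hx = concat β x (hx.trans h.source_eq) := by
  have key (n) : (concat α x hx).init (Λ.d β) = β ∧
      ((concat α x hx).shift (Λ.d β)).init n = x.init n := by
    have hα : Λ.s α = Λ.r (x.init n) := by rw [r_init, hx]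
    have := (init_eq_iff_of_proj_eq R (h.proj_eq (x.init n) hα) (concat α x hx)).1
      ((init_d_comp_eq_iff _ _ _ hα).2 ⟨init_concat _ _ _, by rw [shift_concat, d_init]⟩)
    rwa [init_d_comp_eq_iff, d_init] at this
  refine eq_of_init_eq_of_shift_eq (Λ.d β) ?_ ?_
  · rw [(key 0).1, init_concat]
  · rw [shift_concat]
    exact ext_init fun n => (key n).2

theorem IsCyclinePair.eq_of_aperiodic [Nontrivial R] (hap : Λ.Aperiodic) {α β : Λ.Path}
    (h : IsCyclinePair R α β) : α = β := by
  obtain ⟨x, hx, hnp⟩ := hap (Λ.s α)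
  have hc := h.concat_eq x hx
  have hshift : x.shift (Λ.d α) = x.shift (Λ.d β) := by
    -- Both sides are the shift by `d(α) + d(β)` of the common path `αx = βx`.
    conv_lhs => rw [← shift_concat β x (hx.trans h.source_eq), shift_shift, ← hc, add_comm,
      ← shift_shift, shift_concat]
  have hd : Λ.d α = Λ.d β := by_contra fun hne => hnp ⟨_, _, hne, hshift⟩
  rw [← init_concat α x hx, hc, hd, init_concat]

variable (R) in
theorem isCyclinePair_refl (α : Λ.Path) : IsCyclinePair R α α := ⟨rfl, fun _ _ => rfl⟩

end Representation

end KGraph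

theorem lemma5p5 {k : ℕ} (hk : 0 < k) (Λ : KGraph.{u} k) (hrf : Λ.RowFinite) (hns : Λ.NoSources)
    (hap : Λ.Aperiodic) (R : Type*) [CommRing R] [Nontrivial R] :
    (∀ α β : Λ.Path, KGraph.IsCyclinePair R α β ↔ α = β) ∧
      Λ.cyclineSubalgebra R = Λ.diagonal R := by
  have main (α β : Λ.Path) : KGraph.IsCyclinePair R α β ↔ α = β :=
    ⟨fun h => h.eq_of_aperiodic hap, fun h => h ▸ KGraph.isCyclinePair_refl R α⟩
  refine ⟨main, ?_⟩
  unfold KGraph.cyclineSubalgebra KGraph.diagonal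
  -- With only the pairs `(α, α)` cycline, the two generating sets coincide.
  simp only [main, exists_eq_left']
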